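/- For a finite graph $G=(V,E)$, let $\vartheta(G)$ be its Lovász theta number, i.e. the maximum of $\sum_{(x,y)\in V^2}B(x,y)$ over all real symmetric positive semidefinite matrices $B\in\mathbb{R}^{V\times V}$ with $\sum_{x\in V}B(x,x)=1$ and $B(x,y)=0$ whenever $xy\in E$. For integers $d\ge 1$ and $k\ge 2d$, let $K_{k/d}$ be the circular complete graph, with vertex set $\{0,1,\dots,k-1\}$, in which $i$ and $j$ are adjacent if and only if $d\le |i-j|\le k-d$, and let $\overline{K_{k/d}}$ be its complement. There is an absolute, effective constant $c>0$ (in fact one with $c\le 64$) such that for all $N\in\mathbb{N}$ and all integers $k,k'\le N$ and $d,d'\ge 1$ with $k\ge 2d$, $k'\ge 2d'$, $\gcd(k,d)=\gcd(k',d')=1$ and $k/d\ne k'/d'$, $$\left|\vartheta(\overline{K_{k/d}})-\vartheta(\overline{K_{k'/d'}})\right|\ \ge\ \frac{1}{c^{N^5}}.$$ -/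

import Mathlib

/-- The values `∑ B(x,y)` of the feasible solutions `B` of the semidefinite program defining the
theta number of `G`: `B` is a real symmetric positive semidefinite matrix indexed by the vertices,
of trace `1`, and vanishing on the edges of `G`. -/
def thetaValues {V : Type*} [Fintype V] (G : SimpleGraph V) : Set ℝ :=
  {t | ∃ B : Matrix V V ℝ, B.PosSemidef ∧ ∑ x, B x x = 1 ∧
    (∀ x y, G.Adj x y → B x y = 0) ∧ ∑ x, ∑ y, B x y = t}

/-- Lovász's theta number `ϑ(G)`. For a nonempty vertex set the set of values is nonempty and
compact, so that the supremum is a maximum. -/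
noncomputable def lovaszTheta {V : Type*} [Fintype V] (G : SimpleGraph V) : ℝ :=
  sSup (thetaValues G)

/-- The circular complete graph `K_{k/d}` on `{0, …, k-1}`: `i` and `j` are adjacent if and only if
`d ≤ |i - j| ≤ k - d`. The condition `i ≠ j` is automatic for `d ≥ 1`. -/
def circularComplete (k d : ℕ) : SimpleGraph (Fin k) where
  Adj i j := i ≠ j ∧ (d : ℤ) ≤ |(i : ℤ) - (j : ℤ)| ∧ |(i : ℤ) - (j : ℤ)| ≤ (k : ℤ) - (d : ℤ)
  symm := ⟨fun i j h => ⟨h.1.symm, by rw [abs_sub_comm]; exact h.2⟩⟩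
  loopless := ⟨fun _ h => h.1 rfl⟩

/-! Testing a feasible matrix `B` against the characters of `ℤ / k` turns it into a probability
weight `a` on `ℤ / k`, so `ϑ` of the complement of `K_{k/d}` is `k` times the maximum of `a 0` over
weights whose transform vanishes at the nonzero classes nearer than `d` to `0`. Linear programming
duality supplies a weight `w` with transform supported at the near classes and `a 0 * w 0 = 1 / k`
(`exists_isSparseWeight_isLocalWeight`, `lovaszTheta_compl_circularComplete`).

Distinct ratios give distinct values: `ϑ` is strictly increasing in `k / d`, as one sees by lifting
a primal optimum of one graph and a dual optimum of the other to the modulus `k * k'` and ruling out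
equality there (`IsSparseWeight.mul_lt`).

The values are also arithmetic. By complementary slackness `a` lives on `0` and zeros of `w`, of
which there are at most `2 * d - 2`; interpolation then writes `ϑ` as a quotient of polynomials in
roots of unity (`exists_finset_lovaszTheta_mul_prod`). Clearing denominators in the difference of
two values gives a nonzero algebraic integer in the cyclotomic field of order `k * k'`, with all
conjugates at most `R = 2 * N * 4 ^ N`. Its norm is at least `1` in absolute value, so the
difference is at least `R ^ (-k * k')`, and `R ≤ 64 ^ N`. -/

/-! ### Linear programming duality on the simplex -/

open scoped Matrix in
/-- Strong duality, with complementary optimal solutions, for the pair of linear programs that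
maximise a coordinate over the points of the standard simplex in `(card ι)⁻¹ • 1 + V`, respectively
in `W = Vᗮ`. -/
theorem exists_mem_stdSimplex_mul_eq {ι : Type*} [Fintype ι] [DecidableEq ι] (o : ι)
    (V W : Submodule ℝ (ι → ℝ)) (h1 : (1 : ι → ℝ) ∈ W)
    (hVW : ∀ v ∈ V, ∀ w ∈ W, v ⬝ᵥ w = 0)
    (hdual : ∀ y : ι → ℝ, (∀ v ∈ V, v ⬝ᵥ y = 0) → y ∈ W) :
    ∃ a ∈ stdSimplex ℝ ι, a - (Fintype.card ι : ℝ)⁻¹ • (1 : ι → ℝ) ∈ V ∧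
      ∃ w ∈ stdSimplex ℝ ι, w ∈ W ∧ a o * w o = (Fintype.card ι : ℝ)⁻¹ := by
  have : Nonempty ι := ⟨o⟩
  set c : ℝ := (Fintype.card ι : ℝ)⁻¹ with hc
  have hcard : (0 : ℝ) < Fintype.card ι := by exact_mod_cast Fintype.card_pos
  have hc0 : 0 < c := inv_pos.2 hcard
  have hu : c • (1 : ι → ℝ) ∈ stdSimplex ℝ ι := by
    refine ⟨fun i => by simpa using hc0.le, ?_⟩
    simp [hc, hcard.ne']
  have hcont : Continuous fun x : ι → ℝ => x - c • (1 : ι → ℝ) := by fun_prop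
  have hVcl : IsClosed {x : ι → ℝ | x - c • (1 : ι → ℝ) ∈ V} :=
    (Submodule.closed_of_finiteDimensional V).preimage hcont
  obtain ⟨a, ⟨ha, haV⟩, hamax⟩ :=
    ((isCompact_stdSimplex ℝ ι).inter_right hVcl).exists_isMaxOn
      ⟨_, hu, by simp⟩ (f := fun x : ι → ℝ => x o) (by fun_prop)
  obtain ⟨w, ⟨hw, hwW⟩, hwmax⟩ :=
    ((isCompact_stdSimplex ℝ ι).inter_right (Submodule.closed_of_finiteDimensional W)).exists_isMaxOn
      ⟨_, hu, W.smul_mem c h1⟩ (f := fun x : ι → ℝ => x o) (by fun_prop)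
  have hwc : c ≤ w o := by
    have := hwmax (show c • (1 : ι → ℝ) ∈ _ from ⟨hu, W.smul_mem c h1⟩)
    simpa using this
  have hw0 : 0 < w o := hc0.trans_le hwc
  refine ⟨a, ha, haV, w, hw, hwW, le_antisymm ?_ ?_⟩
  · have hz : (a - c • (1 : ι → ℝ)) ⬝ᵥ w = 0 := hVW _ haV _ hwW
    have hs : a ⬝ᵥ w = c := by
      rw [sub_dotProduct, smul_dotProduct, one_dotProduct, hw.2] at hz
      simp at hz
      linarith
    rw [← hs]
    exact Finset.single_le_sum (f := fun i => a i * w i)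
      (fun i _ => mul_nonneg (ha.1 i) (hw.1 i)) (Finset.mem_univ o)
  · by_contra! hlt
    -- `s` is the optimum predicted by duality. If `a o` falls short of it, the compact slice `s ≤ x
    -- o` of the simplex misses the affine space, and the two can be strictly separated.
    set s : ℝ := c / w o with hs
    have has : a o < s := by rwa [hs, lt_div_iff₀ hw0]
    have hs0 : 0 < s := div_pos hc0 hw0
    have hs1 : s ≤ 1 := by rwa [hs, div_le_one hw0]
    have hKc : IsCompact (stdSimplex ℝ ι ∩ {x | s ≤ x o}) :=
      (isCompact_stdSimplex ℝ ι).inter_right (isClosed_le continuous_const (continuous_apply o))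
    have hKconv : Convex ℝ (stdSimplex ℝ ι ∩ {x | s ≤ x o}) :=
      (convex_stdSimplex ℝ ι).inter
        (convex_halfSpace_ge (LinearMap.isLinear (LinearMap.proj o : (ι → ℝ) →ₗ[ℝ] ℝ)) s)
    have hVconv : Convex ℝ {x : ι → ℝ | x - c • (1 : ι → ℝ) ∈ V} := by
      intro x hx y hy p q _ _ hpq
      have : p • x + q • y - c • (1 : ι → ℝ) =
          p • (x - c • (1 : ι → ℝ)) + q • (y - c • (1 : ι → ℝ)) := by
        ext i
        simp only [Pi.sub_apply, Pi.add_apply, Pi.smul_apply, Pi.one_apply, smul_eq_mul]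
        linear_combination c * hpq
      rw [Set.mem_ofPred_eq, this]
      exact V.add_mem (V.smul_mem _ hx) (V.smul_mem _ hy)
    have hdisj : Disjoint (stdSimplex ℝ ι ∩ {x | s ≤ x o})
        {x : ι → ℝ | x - c • (1 : ι → ℝ) ∈ V} := by
      rw [Set.disjoint_left]
      rintro x ⟨hx, hxs⟩ hxV
      have := hamax (show x ∈ _ from ⟨hx, hxV⟩)
      simp only [Set.mem_ofPred_eq] at this hxs
      linarith
    obtain ⟨f, u, v, hfu, huv, hvf⟩ :=
      geometric_hahn_banach_compact_closed hKconv hKc hVconv hVcl hdisj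
    set y : ι → ℝ := fun i => - f (Pi.single i 1) with hy
    have hfy : ∀ x : ι → ℝ, f x = - (x ⬝ᵥ y) := by
      intro x
      have := f.toLinearMap.pi_apply_eq_sum_univ x
      simp only [ContinuousLinearMap.coe_coe] at this
      rw [this, dotProduct, ← Finset.sum_neg_distrib]
      refine Finset.sum_congr rfl fun i _ => ?_
      simp only [hy, smul_eq_mul, mul_neg, neg_neg]
      congr 2
      ext j
      simp [Pi.single_apply, eq_comm]
    have hyV : ∀ z ∈ V, z ⬝ᵥ y = 0 := by
      intro z hz
      by_contra hne
      -- A functional bounded below on a translate of `V` vanishes on `V`: this point would have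
      -- value exactly `v`.
      have := hvf (c • (1 : ι → ℝ) + ((v - f (c • (1 : ι → ℝ))) / f z) • z) (by
        simpa using V.smul_mem _ hz)
      rw [map_add, f.map_smul (_ / _), smul_eq_mul, div_mul_cancel₀] at this
      · linarith
      · rw [hfy]; simpa using hne
    have hyW := hdual y hyV
    obtain ⟨i₀, hi₀⟩ := Finite.exists_min y
    have hc1 : v < - (c * ∑ i, y i) := by
      have := hvf (c • (1 : ι → ℝ)) (by simp)
      rwa [hfy, smul_dotProduct, one_dotProduct, smul_eq_mul] at this
    have hx : - (s * y o + (1 - s) * y i₀) < u := by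
      have := hfu (s • Pi.single o 1 + (1 - s) • Pi.single i₀ 1)
        ⟨(convex_stdSimplex ℝ ι) (single_mem_stdSimplex ℝ o) (single_mem_stdSimplex ℝ i₀) hs0.le
          (by linarith) (by ring), by
          simp only [Set.mem_ofPred_eq, Pi.add_apply, Pi.smul_apply, Pi.single_eq_same, smul_eq_mul,
            mul_one, le_add_iff_nonneg_right]
          refine mul_nonneg (by linarith) ?_
          rw [Pi.single_apply]; split_ifs <;> norm_num⟩
      rw [hfy, add_dotProduct, smul_dotProduct, smul_dotProduct, single_dotProduct,
        single_dotProduct] at this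
      simpa using this
    -- Shifting by the minimum makes the separating vector nonnegative; normalised, it lies in the
    -- simplex and beats `w` at `o`.
    set G : ι → ℝ := y - y i₀ • (1 : ι → ℝ) with hG
    have hGW : G ∈ W := W.sub_mem hyW (W.smul_mem _ h1)
    have hG0 : ∀ i, 0 ≤ G i := fun i => by simpa [hG] using hi₀ i
    have hGs : c * ∑ i, G i = c * ∑ i, y i - y i₀ := by
      simp only [hG, Pi.sub_apply, Pi.smul_apply, Pi.one_apply, smul_eq_mul, mul_one,
        Finset.sum_sub_distrib, Finset.sum_const, Finset.card_univ, nsmul_eq_mul, mul_sub]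
      rw [← mul_assoc, hc, inv_mul_cancel₀ hcard.ne', one_mul]
    have hGo : G o = y o - y i₀ := by simp [hG]
    have hlt' : c * ∑ i, G i < s * G o := by rw [hGs, hGo]; nlinarith
    have hGle : G o ≤ ∑ i, G i :=
      Finset.single_le_sum (f := G) (fun i _ => hG0 i) (Finset.mem_univ o)
    have hGpos : 0 < ∑ i, G i := by
      rcases (Finset.sum_nonneg fun i _ => hG0 i : 0 ≤ ∑ i, G i).lt_or_eq with h | h
      · exact h
      · rw [← h] at hlt' hGle
        nlinarith
    have := hwmax (show (∑ i, G i)⁻¹ • G ∈ _ from ⟨⟨fun i => by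
      simpa using mul_nonneg (inv_nonneg.2 hGpos.le) (hG0 i), by
      simp [← Finset.mul_sum, hGpos.ne']⟩, W.smul_mem _ hGW⟩)
    simp only [Set.mem_ofPred_eq, Pi.smul_apply, smul_eq_mul] at this
    rw [inv_mul_le_iff₀ hGpos] at this
    have h2 : s * w o = c := div_mul_cancel₀ _ hw0.ne'
    nlinarith

/-! ### Weights on `ℤ / k` and their Fourier transforms -/

/-- The characteristic function `j ↦ ∑ n, a n e(n j / k)` of a weight on `ℤ / k`. -/
noncomputable def fourierSum {k : ℕ} [NeZero k] (a : ZMod k → ℝ) (j : ZMod k) : ℂ :=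
  ∑ n, (a n : ℂ) * ZMod.stdAddChar (n * j)

/-- The residue classes at distance less than `d` from `0`. -/
def IsNear {k : ℕ} (d : ℕ) (j : ZMod k) : Prop :=
  ∃ m : ℤ, |m| < d ∧ (m : ZMod k) = j

/-- The probability weights on `ℤ / k` whose characteristic function vanishes at the nonzero
residue classes at distance less than `d` from `0`. -/
structure IsSparseWeight {k : ℕ} [NeZero k] (d : ℕ) (a : ZMod k → ℝ) : Prop where
  mem_stdSimplex : a ∈ stdSimplex ℝ (ZMod k)
  fourierSum_eq_zero : ∀ j, j ≠ 0 → IsNear d j → fourierSum a j = 0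

/-- The probability weights on `ℤ / k` whose characteristic function is supported at the
residue classes at distance less than `d` from `0`. -/
structure IsLocalWeight {k : ℕ} [NeZero k] (d : ℕ) (w : ZMod k → ℝ) : Prop where
  mem_stdSimplex : w ∈ stdSimplex ℝ (ZMod k)
  fourierSum_eq_zero : ∀ j, ¬ IsNear d j → fourierSum w j = 0

theorem IsNear.neg {k d : ℕ} {j : ZMod k} (h : IsNear d j) : IsNear d (-j) := by
  obtain ⟨m, hm, rfl⟩ := h
  exact ⟨-m, by rwa [abs_neg], by push_cast; rfl⟩

theorem isNear_zero {k d : ℕ} (hd : 1 ≤ d) : IsNear d (0 : ZMod k) :=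
  ⟨0, by simp; omega, by simp⟩

section

variable {k : ℕ} [NeZero k]

theorem sum_stdAddChar_mul (b : ZMod k) :
    ∑ x : ZMod k, ZMod.stdAddChar (x * b) = if b = 0 then (k : ℂ) else 0 := by
  rw [AddChar.sum_mulShift b (ZMod.isPrimitive_stdAddChar k), ZMod.card]
  split_ifs <;> simp

theorem fourierSum_zero (a : ZMod k → ℝ) : fourierSum a 0 = ((∑ n, a n : ℝ) : ℂ) := by
  simp [fourierSum]

theorem fourierSum_zero_of_mem {a : ZMod k → ℝ} (ha : a ∈ stdSimplex ℝ (ZMod k)) :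
    fourierSum a 0 = 1 := by
  rw [fourierSum_zero, ha.2, Complex.ofReal_one]

theorem sum_fourierSum_mul_fourierSum (a w : ZMod k → ℝ) (x : ZMod k) :
    ∑ j, fourierSum a j * fourierSum w (x - j) =
      k * ∑ n, (a n * w n : ℂ) * ZMod.stdAddChar (n * x) := by
  simp only [fourierSum, Finset.sum_mul_sum]
  rw [Finset.sum_comm, Finset.mul_sum]
  refine Finset.sum_congr rfl fun n _ => ?_
  rw [Finset.sum_comm]
  have : ∀ m : ZMod k, ∑ j : ZMod k, (a n : ℂ) * ZMod.stdAddChar (n * j) *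
      (w m * ZMod.stdAddChar (m * (x - j))) =
      a n * w m * ZMod.stdAddChar (m * x) * if n - m = 0 then (k : ℂ) else 0 := by
    intro m
    rw [← sum_stdAddChar_mul, Finset.mul_sum]
    refine Finset.sum_congr rfl fun j _ => ?_
    have : ZMod.stdAddChar (n * j) * ZMod.stdAddChar (m * (x - j)) =
        ZMod.stdAddChar (m * x) * (ZMod.stdAddChar (j * (n - m)) : ℂ) := by
      rw [← AddChar.map_add_eq_mul, ← AddChar.map_add_eq_mul]
      congr 1; ring
    linear_combination (a n : ℂ) * w m * this
  simp only [this, sub_eq_zero, mul_ite, mul_zero, Finset.sum_ite_eq, Finset.mem_univ, if_true]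
  ring

/-- In the convolution of the two transforms only the term `j = 0` survives. The case `x = 0` is
weak duality; `x = 1` gives strictness later. -/
theorem IsSparseWeight.sum_mul_stdAddChar_eq {d d' : ℕ} {a w : ZMod k → ℝ}
    (ha : IsSparseWeight d a) (hw : IsLocalWeight d' w) {x : ZMod k}
    (hx : ∀ j : ZMod k, j ≠ 0 → ¬ IsNear d j → ¬ IsNear d' (x - j)) :
    (k : ℂ) * ∑ n, (a n * w n : ℂ) * ZMod.stdAddChar (n * x) = fourierSum w x := by
  rw [← sum_fourierSum_mul_fourierSum, Finset.sum_eq_single 0]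
  · rw [fourierSum_zero_of_mem ha.mem_stdSimplex, one_mul, sub_zero]
  · intro j _ hj
    by_cases h : IsNear d j
    · rw [ha.fourierSum_eq_zero j hj h, zero_mul]
    · rw [hw.fourierSum_eq_zero _ (hx j hj h), mul_zero]
  · simp

theorem IsSparseWeight.sum_mul_eq {d : ℕ} {a w : ZMod k → ℝ}
    (ha : IsSparseWeight d a) (hw : IsLocalWeight d w) :
    ∑ n, a n * w n = (k : ℝ)⁻¹ := by
  have h := ha.sum_mul_stdAddChar_eq hw (x := 0) fun j _ hj hj' => hj (by simpa using hj'.neg)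
  rw [fourierSum_zero_of_mem hw.mem_stdSimplex] at h
  simp only [mul_zero, AddChar.map_zero_eq_one, mul_one] at h
  exact eq_inv_of_mul_eq_one_right (by exact_mod_cast h)

/-- Complementary slackness: the nonnegative terms `a n * w n` sum to what the term at `0` already
contributes. -/
theorem IsSparseWeight.mul_eq_zero {d : ℕ} {a w : ZMod k → ℝ}
    (ha : IsSparseWeight d a) (hw : IsLocalWeight d w) (h : a 0 * w 0 = (k : ℝ)⁻¹)
    {n : ZMod k} (hn : n ≠ 0) : a n * w n = 0 := by
  have hs := ha.sum_mul_eq hw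
  rw [← Finset.add_sum_erase _ _ (Finset.mem_univ (0 : ZMod k)), h, add_eq_left,
    Finset.sum_eq_zero_iff_of_nonneg fun i _ =>
      mul_nonneg (ha.mem_stdSimplex.1 i) (hw.mem_stdSimplex.1 i)] at hs
  exact hs n (by simpa using hn)

theorem fourierSum_add (v w : ZMod k → ℝ) (j : ZMod k) :
    fourierSum (v + w) j = fourierSum v j + fourierSum w j := by
  simp [fourierSum, add_mul, Finset.sum_add_distrib]

theorem fourierSum_smul (c : ℝ) (v : ZMod k → ℝ) (j : ZMod k) :
    fourierSum (c • v) j = c * fourierSum v j := by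
  simp [fourierSum, Finset.mul_sum, mul_assoc]

/-- The weights whose characteristic function vanishes on the set `s`. -/
noncomputable def fourierVanishing (s : Set (ZMod k)) : Submodule ℝ (ZMod k → ℝ) where
  carrier := {v | ∀ j ∈ s, fourierSum v j = 0}
  add_mem' hv hw j hj := by rw [fourierSum_add, hv j hj, hw j hj, add_zero]
  zero_mem' j _ := by simp [fourierSum]
  smul_mem' c v hv j hj := by rw [fourierSum_smul, hv j hj, mul_zero]

theorem fourierSum_one {j : ZMod k} (hj : j ≠ 0) : fourierSum (1 : ZMod k → ℝ) j = 0 := by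
  have := sum_stdAddChar_mul j
  rw [if_neg hj] at this
  simpa [fourierSum] using this

/-- Since `s` is symmetric, the real and imaginary parts of its characters lie in `fourierVanishing
sᶜ` and may be used as test vectors. -/
theorem mem_fourierVanishing_of_orthogonal {s : Set (ZMod k)} (hs : ∀ j ∈ s, -j ∈ s)
    (y : ZMod k → ℝ) (hy : ∀ v ∈ fourierVanishing sᶜ, v ⬝ᵥ y = 0) : y ∈ fourierVanishing s := by
  intro j hj
  have hχ : ∀ n : ZMod k, (starRingEnd ℂ) (ZMod.stdAddChar (n * j)) =
      ZMod.stdAddChar (n * (-j)) := fun n => by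
    rw [mul_neg, AddChar.map_neg_eq_conj]
  have hvan : ∀ i ∈ sᶜ, ∀ l ∈ s,
      ∑ n : ZMod k, ZMod.stdAddChar (n * l) * (ZMod.stdAddChar (n * i) : ℂ) = 0 := by
    intro i hi l hl
    simp only [← AddChar.map_add_eq_mul, ← mul_add]
    rw [sum_stdAddChar_mul, if_neg]
    intro h
    exact hi (by rw [← neg_eq_of_add_eq_zero_right h]; exact hs l hl)
  have hre := hy (fun n => (ZMod.stdAddChar (n * j) : ℂ).re) fun i hi => by
    simp only [fourierSum, Complex.re_eq_add_conj, hχ, add_div, add_mul, div_mul_eq_mul_div,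
      Finset.sum_add_distrib, ← Finset.sum_div]
    rw [hvan i hi j hj, hvan i hi (-j) (hs j hj)]
    simp
  have him := hy (fun n => (ZMod.stdAddChar (n * j) : ℂ).im) fun i hi => by
    simp only [fourierSum, Complex.im_eq_sub_conj, hχ, sub_div, sub_mul, div_mul_eq_mul_div,
      Finset.sum_sub_distrib, ← Finset.sum_div]
    rw [hvan i hi j hj, hvan i hi (-j) (hs j hj)]
    simp
  apply Complex.ext
  · simpa [fourierSum, dotProduct, mul_comm] using hre
  · simpa [fourierSum, dotProduct, mul_comm] using him

theorem exists_isSparseWeight_isLocalWeight {d : ℕ} (hd : 1 ≤ d) :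
    ∃ a w : ZMod k → ℝ, IsSparseWeight d a ∧ IsLocalWeight d w ∧ a 0 * w 0 = (k : ℝ)⁻¹ := by
  set s : Set (ZMod k) := {j | ¬ IsNear d j} with hs
  have hneg : ∀ j ∈ s, -j ∈ s := fun j hj h => hj (by simpa using h.neg)
  obtain ⟨a, ha, haV, w, hw, hwW, h⟩ := exists_mem_stdSimplex_mul_eq (0 : ZMod k)
    (fourierVanishing sᶜ) (fourierVanishing s)
    (fun j hj => fourierSum_one fun h0 => hj (h0 ▸ isNear_zero hd))
    (fun v hv w hw => by
      have hsum := sum_fourierSum_mul_fourierSum v w 0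
      rw [Finset.sum_eq_zero] at hsum
      · simp only [mul_zero, AddChar.map_zero_eq_one, mul_one] at hsum
        have := (mul_eq_zero.1 hsum.symm).resolve_left (NeZero.ne _)
        exact_mod_cast this
      · intro j _
        by_cases hj : j ∈ s
        · rw [hw (0 - j) (by simpa using hneg j hj), mul_zero]
        · rw [hv j hj, zero_mul])
    (mem_fourierVanishing_of_orthogonal hneg)
  rw [ZMod.card] at *
  refine ⟨a, w, ⟨ha, fun j hj hn => ?_⟩, ⟨hw, fun j hj => hwW j hj⟩, h⟩
  have := haV j (by simpa [hs] using hn)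
  rw [sub_eq_add_neg, ← neg_smul, fourierSum_add, fourierSum_smul, fourierSum_one hj] at this
  simpa using this

end

/-! ### Reduction of the theta number to weights -/

section

variable {k : ℕ}

theorem Fin.bijective_natCast_zmod [NeZero k] : Function.Bijective fun i : Fin k => ((i : ℕ) : ZMod k) := by
  refine (Fintype.bijective_iff_injective_and_card _).2 ⟨fun i j h => ?_, by simp [ZMod.card]⟩
  have := (ZMod.natCast_eq_natCast_iff' _ _ _).1 h
  rwa [Nat.mod_eq_of_lt i.2, Nat.mod_eq_of_lt j.2, ← Fin.ext_iff] at this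

theorem circularComplete_adj_iff {d : ℕ} (hd : 1 ≤ d) (i j : Fin k) :
    (circularComplete k d).Adj i j ↔ ¬ IsNear d ((i : ℕ) - (j : ℕ) : ZMod k) := by
  have hi := i.2
  have hj := j.2
  constructor
  · rintro ⟨-, h1, h2⟩ ⟨m, hm, h⟩
    have h' : ((m : ℤ) : ZMod k) = (((i : ℤ) - (j : ℤ) : ℤ) : ZMod k) := by push_cast; exact h
    obtain ⟨t, ht⟩ := (ZMod.intCast_eq_intCast_iff_dvd_sub _ _ _).1 h'
    rcases lt_trichotomy t 0 with h0 | rfl | h0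
    · have : (k : ℤ) * t ≤ -k := by nlinarith
      cases abs_cases m <;> cases abs_cases ((i : ℤ) - (j : ℤ)) <;> omega
    · cases abs_cases m <;> cases abs_cases ((i : ℤ) - (j : ℤ)) <;> omega
    · have : (k : ℤ) ≤ k * t := by nlinarith
      cases abs_cases m <;> cases abs_cases ((i : ℤ) - (j : ℤ)) <;> omega
  · intro h
    have h1 : (d : ℤ) ≤ |(i : ℤ) - (j : ℤ)| := by
      by_contra! hlt
      exact h ⟨_, hlt, by push_cast; rfl⟩
    refine ⟨?_, h1, ?_⟩
    · rintro rfl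
      simp at h1
      omega
    · by_contra! hlt
      rcases abs_cases ((i : ℤ) - (j : ℤ)) with h' | h'
      · exact h ⟨(i : ℤ) - j - k, by rw [abs_lt]; omega, by push_cast; simp⟩
      · exact h ⟨(i : ℤ) - j + k, by rw [abs_lt]; omega, by push_cast; simp⟩

variable [NeZero k]

/-- A real matrix indexed by `Fin k` has the weights given by its quadratic form at the
characters of `ℤ / k`. -/
noncomputable def characterWeight (B : Matrix (Fin k) (Fin k) ℝ) (n : ZMod k) : ℝ :=
  (k : ℝ)⁻¹ * (∑ x, ∑ y, (B x y : ℂ) *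
    ZMod.stdAddChar (n * ((x : ℕ) - (y : ℕ) : ZMod k))).re

theorem re_stdAddChar_sub (n u v : ZMod k) :
    (ZMod.stdAddChar (n * (u - v)) : ℂ).re =
      (ZMod.stdAddChar (n * u) : ℂ).re * (ZMod.stdAddChar (n * v) : ℂ).re +
      (ZMod.stdAddChar (n * u) : ℂ).im * (ZMod.stdAddChar (n * v) : ℂ).im := by
  rw [mul_sub, sub_eq_add_neg, AddChar.map_add_eq_mul, AddChar.map_neg_eq_conj]
  simp

/-- The real part splits into the quadratic form of `B` at the cosine vector plus that at the sine
vector. -/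
theorem characterWeight_nonneg {B : Matrix (Fin k) (Fin k) ℝ} (hB : B.PosSemidef) (n : ZMod k) :
    0 ≤ characterWeight B n := by
  refine mul_nonneg (by positivity) ?_
  have h (v : Fin k → ℝ) : 0 ≤ ∑ x, ∑ y, B x y * (v x * v y) := by
    have := hB.dotProduct_mulVec_nonneg v
    simp only [dotProduct, Matrix.mulVec, Finset.mul_sum, star_trivial] at this
    refine this.trans_eq (Finset.sum_congr rfl fun x _ => Finset.sum_congr rfl fun y _ => ?_)
    ring
  simp only [Complex.re_sum, Complex.re_ofReal_mul, re_stdAddChar_sub, mul_add,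
    Finset.sum_add_distrib]
  exact add_nonneg (h _) (h _)

theorem ofReal_characterWeight {B : Matrix (Fin k) (Fin k) ℝ} (hB : B.PosSemidef) (n : ZMod k) :
    (characterWeight B n : ℂ) = (k : ℂ)⁻¹ * ∑ x, ∑ y, (B x y : ℂ) *
      ZMod.stdAddChar (n * ((x : ℕ) - (y : ℕ) : ZMod k)) := by
  rw [characterWeight]
  push_cast
  congr 1
  rw [← Complex.conj_eq_iff_re, map_sum, Finset.sum_congr rfl fun x _ => map_sum _ _ _,
    Finset.sum_comm]
  refine Finset.sum_congr rfl fun x _ => Finset.sum_congr rfl fun y _ => ?_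
  rw [map_mul, Complex.conj_ofReal, ← AddChar.map_neg_eq_conj, ← mul_neg, neg_sub]
  congr 2
  simpa using hB.1.apply x y

theorem fourierSum_characterWeight {B : Matrix (Fin k) (Fin k) ℝ} (hB : B.PosSemidef)
    (j : ZMod k) : fourierSum (characterWeight B) j =
      ∑ x : Fin k, ∑ y : Fin k,
        if ((x : ℕ) - (y : ℕ) : ZMod k) + j = 0 then (B x y : ℂ) else 0 := by
  have hk : (k : ℂ) ≠ 0 := NeZero.ne _
  simp only [fourierSum, ofReal_characterWeight hB, Finset.mul_sum, Finset.sum_mul]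
  rw [Finset.sum_comm]
  refine Finset.sum_congr rfl fun x _ => ?_
  rw [Finset.sum_comm]
  refine Finset.sum_congr rfl fun y _ => ?_
  have h : ∀ n : ZMod k, (k : ℂ)⁻¹ * ((B x y : ℂ) *
      ZMod.stdAddChar (n * ((x : ℕ) - (y : ℕ) : ZMod k))) * ZMod.stdAddChar (n * j) =
      (k : ℂ)⁻¹ * B x y * ZMod.stdAddChar (n * (((x : ℕ) - (y : ℕ) : ZMod k) + j)) := by
    intro n
    rw [mul_add n, AddChar.map_add_eq_mul]
    ring
  simp only [h]
  rw [← Finset.mul_sum, sum_stdAddChar_mul]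
  split_ifs
  · field_simp
  · simp

theorem isSparseWeight_characterWeight {d : ℕ} (hd : 1 ≤ d)
    {B : Matrix (Fin k) (Fin k) ℝ} (hB : B.PosSemidef) (htr : ∑ x, B x x = 1)
    (hadj : ∀ x y, (circularComplete k d)ᶜ.Adj x y → B x y = 0) :
    IsSparseWeight d (characterWeight B) := by
  have hinj : ∀ x y : Fin k, ((x : ℕ) - (y : ℕ) : ZMod k) = 0 ↔ x = y := fun x y => by
    rw [sub_eq_zero]
    exact Fin.bijective_natCast_zmod.1.eq_iff
  refine ⟨⟨characterWeight_nonneg hB, ?_⟩, fun j hj hn => ?_⟩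
  · have h := fourierSum_characterWeight hB 0
    simp only [add_zero, hinj, Finset.sum_ite_eq, Finset.mem_univ, if_true] at h
    rw [fourierSum_zero] at h
    rw [← htr]
    exact_mod_cast h
  · rw [fourierSum_characterWeight hB]
    refine Finset.sum_eq_zero fun x _ => Finset.sum_eq_zero fun y _ => ?_
    split_ifs with h
    · have hxy : ((x : ℕ) - (y : ℕ) : ZMod k) = -j := eq_neg_of_add_eq_zero_left h
      rw [hadj x y, Complex.ofReal_zero]
      rw [SimpleGraph.compl_adj, circularComplete_adj_iff hd, not_not, hxy, ne_eq, ← hinj, hxy]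
      exact ⟨by simpa using hj, hn.neg⟩
    · rfl

/-- The witness is the circulant matrix with spectrum `a`, a nonnegative combination of rank-one
cosine and sine matrices. -/
theorem IsSparseWeight.mem_thetaValues {d : ℕ} (hd : 1 ≤ d)
    {a : ZMod k → ℝ} (ha : IsSparseWeight d a) :
    k * a 0 ∈ thetaValues (circularComplete k d)ᶜ := by
  have hk0 : (k : ℝ) ≠ 0 := NeZero.ne _
  refine ⟨fun x y => (k : ℝ)⁻¹ * (fourierSum a ((x : ℕ) - (y : ℕ) : ZMod k)).re, ?_, ?_, ?_, ?_⟩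
  · have : (fun x y => (k : ℝ)⁻¹ * (fourierSum a ((x : ℕ) - (y : ℕ) : ZMod k)).re :
        Matrix (Fin k) (Fin k) ℝ) = (k : ℝ)⁻¹ • ∑ n, a n •
          (Matrix.vecMulVec (fun x : Fin k => (ZMod.stdAddChar (n * ((x : ℕ) : ZMod k)) : ℂ).re)
              (star fun x : Fin k => (ZMod.stdAddChar (n * ((x : ℕ) : ZMod k)) : ℂ).re) +
            Matrix.vecMulVec (fun x : Fin k => (ZMod.stdAddChar (n * ((x : ℕ) : ZMod k)) : ℂ).im)
              (star fun x : Fin k => (ZMod.stdAddChar (n * ((x : ℕ) : ZMod k)) : ℂ).im)) := by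
      ext x y
      simp only [fourierSum, Complex.re_sum, Complex.re_ofReal_mul, re_stdAddChar_sub,
        Matrix.smul_apply, Matrix.sum_apply, Matrix.add_apply, Matrix.vecMulVec_apply,
        star_trivial, smul_eq_mul]
    rw [this]
    exact (Matrix.posSemidef_sum _ fun n _ => ((Matrix.posSemidef_vecMulVec_self_star _).add
      (Matrix.posSemidef_vecMulVec_self_star _)).smul (ha.mem_stdSimplex.1 n)).smul (by positivity)
  · simp [fourierSum_zero_of_mem ha.mem_stdSimplex, hk0]
  · intro x y h
    rw [SimpleGraph.compl_adj, circularComplete_adj_iff hd, not_not] at h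
    beta_reduce
    rw [ha.fourierSum_eq_zero _ _ h.2]
    · simp
    · rw [sub_ne_zero]
      exact fun h' => h.1 (Fin.bijective_natCast_zmod.1 h')
  · have hrow : ∀ x : Fin k, ∑ y : Fin k, fourierSum a ((x : ℕ) - (y : ℕ) : ZMod k) =
        k * a 0 := by
      intro x
      rw [Fin.bijective_natCast_zmod.sum_comp fun y => fourierSum a (((x : ℕ) : ZMod k) - y),
        show ∑ y, fourierSum a (((x : ℕ) : ZMod k) - y) = ∑ y, fourierSum a y from
          (Equiv.subLeft ((x : ℕ) : ZMod k)).sum_comp (fourierSum a)]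
      have h : ∀ n : ZMod k, ∑ i : ZMod k, (ZMod.stdAddChar (n * i) : ℂ) =
          if n = 0 then (k : ℂ) else 0 := fun n => by
        simp only [← sum_stdAddChar_mul, mul_comm]
      simp only [fourierSum]
      rw [Finset.sum_comm]
      simp only [← Finset.mul_sum, h]
      simp [mul_comm]
    simp only [← Finset.mul_sum, ← Complex.re_sum, hrow]
    rw [Finset.sum_const, Finset.card_univ, Fintype.card_fin, nsmul_eq_mul,
      show (k : ℂ) * (k * a 0) = ((k * (k * a 0) : ℝ) : ℂ) by push_cast; rfl, Complex.ofReal_re]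
    field_simp

theorem lovaszTheta_compl_circularComplete {d : ℕ} (hd : 1 ≤ d)
    {a w : ZMod k → ℝ} (ha : IsSparseWeight d a) (hw : IsLocalWeight d w)
    (h : a 0 * w 0 = (k : ℝ)⁻¹) : lovaszTheta (circularComplete k d)ᶜ = k * a 0 := by
  have hk0 : (0 : ℝ) < k := by exact_mod_cast Nat.pos_of_neZero k
  refine IsGreatest.csSup_eq ⟨ha.mem_thetaValues hd, ?_⟩
  rintro t ⟨B, hB, htr, hadj, rfl⟩
  have hs := isSparseWeight_characterWeight hd hB htr hadj
  have h0 : characterWeight B 0 = (k : ℝ)⁻¹ * ∑ x, ∑ y, B x y := by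
    simp [characterWeight]
  have hle : characterWeight B 0 * w 0 ≤ a 0 * w 0 := by
    rw [h, ← hs.sum_mul_eq hw]
    exact Finset.single_le_sum (f := fun n => characterWeight B n * w n)
      (fun n _ => mul_nonneg (hs.mem_stdSimplex.1 n) (hw.mem_stdSimplex.1 n)) (Finset.mem_univ _)
  have hw0 : 0 < w 0 := (hw.mem_stdSimplex.1 0).lt_of_ne' fun h' => by
    rw [h', mul_zero] at h
    exact (inv_pos.2 hk0).ne h
  have := le_of_mul_le_mul_right hle hw0
  rwa [h0, inv_mul_le_iff₀ hk0] at this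

end

/-! ### Strictness in weak duality -/

theorem not_isNear_self {k d : ℕ} (hk : 2 * d ≤ k) : ¬ IsNear d (d : ZMod k) := by
  rintro ⟨m, hm, h⟩
  rw [← Int.cast_natCast (R := ZMod k) d, ZMod.intCast_eq_intCast_iff_dvd_sub] at h
  rw [abs_lt] at hm
  have := Int.le_of_dvd (by omega) h
  omega

section

variable {k : ℕ} [NeZero k]

theorem sum_fourierSum_mul_stdAddChar (a : ZMod k → ℝ) (n : ZMod k) :
    ∑ m, fourierSum a m * ZMod.stdAddChar (-(n * m)) = k * a n := by
  simp only [fourierSum, Finset.sum_mul]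
  rw [Finset.sum_comm]
  have : ∀ i : ZMod k, ∑ m : ZMod k, (a i : ℂ) * ZMod.stdAddChar (i * m) *
      ZMod.stdAddChar (-(n * m)) = a i * if i - n = 0 then (k : ℂ) else 0 := by
    intro i
    rw [← sum_stdAddChar_mul, Finset.mul_sum]
    refine Finset.sum_congr rfl fun m _ => ?_
    rw [mul_assoc, ← AddChar.map_add_eq_mul]
    congr 3; ring
  simp only [this, sub_eq_zero, mul_ite, mul_zero, Finset.sum_ite_eq', Finset.mem_univ, if_true]
  ring

/-- Equality would align all phases and concentrate `w` at `0`; its transform would then be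
constantly `1`, yet it vanishes at the class of `d`. -/
theorem IsLocalWeight.fourierSum_one_ne_one {d : ℕ} (hk : 2 * d ≤ k)
    {w : ZMod k → ℝ} (hw : IsLocalWeight d w) : fourierSum w 1 ≠ 1 := by
  intro h
  have hle : ∀ n : ZMod k, (ZMod.stdAddChar n : ℂ).re ≤ 1 := fun n =>
    (Complex.re_le_norm _).trans_eq (AddChar.norm_apply _ _)
  have hsum : ∑ n, w n * (1 - (ZMod.stdAddChar n : ℂ).re) = 0 := by
    have := congrArg Complex.re h
    simp only [fourierSum, mul_one, Complex.re_sum, Complex.re_ofReal_mul, Complex.one_re] at this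
    simp only [mul_sub, mul_one, Finset.sum_sub_distrib]
    rw [this, hw.mem_stdSimplex.2, sub_self]
  rw [Finset.sum_eq_zero_iff_of_nonneg fun n _ =>
    mul_nonneg (hw.mem_stdSimplex.1 n) (sub_nonneg.2 (hle n))] at hsum
  have h0 : ∀ n, n ≠ 0 → w n = 0 := by
    intro n hn
    refine (mul_eq_zero.1 (hsum n (Finset.mem_univ n))).resolve_right fun h1 => hn ?_
    refine ZMod.injective_stdAddChar ?_
    rw [AddChar.map_zero_eq_one]
    have hnorm : ‖(ZMod.stdAddChar n : ℂ)‖ = 1 := AddChar.norm_apply _ _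
    have hre : (ZMod.stdAddChar n : ℂ).re = 1 := by linarith
    have him := Complex.sq_norm_sub_sq_re (ZMod.stdAddChar n)
    rw [hnorm, hre, sub_self, eq_comm, sq_eq_zero_iff] at him
    exact Complex.ext hre him
  have hd' := hw.fourierSum_eq_zero _ (not_isNear_self hk)
  have hw0 := hw.mem_stdSimplex.2
  rw [Finset.sum_eq_single 0 (fun n _ hn => h0 n hn) (by simp)] at hw0
  rw [fourierSum, Finset.sum_eq_single 0 (fun n _ hn => by simp [h0 n hn]) (by simp), hw0] at hd'
  simp at hd'

theorem IsSparseWeight.mono {d d' : ℕ} (h : d' ≤ d) {a : ZMod k → ℝ} (ha : IsSparseWeight d a) :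
    IsSparseWeight d' a :=
  ⟨ha.mem_stdSimplex, fun j hj ⟨m, hm, hmj⟩ =>
    ha.fourierSum_eq_zero j hj ⟨m, hm.trans_le (by exact_mod_cast h), hmj⟩⟩

/-- Equality would concentrate `a * w` at `0`. The spare room `d' < d` allows the convolution
identity at `x = 1` as well, which forces the transform of `w` to be `1` there. -/
theorem IsSparseWeight.mul_lt {d d' : ℕ} (hk : 2 * d' ≤ k) (hlt : d' < d)
    {a w : ZMod k → ℝ} (ha : IsSparseWeight d a) (hw : IsLocalWeight d' w) :
    a 0 * w 0 < (k : ℝ)⁻¹ := by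
  have ha' := ha.mono hlt.le
  refine lt_of_le_of_ne ?_ fun h => ?_
  · rw [← ha'.sum_mul_eq hw]
    exact Finset.single_le_sum (f := fun n => a n * w n)
      (fun n _ => mul_nonneg (ha.mem_stdSimplex.1 n) (hw.mem_stdSimplex.1 n)) (Finset.mem_univ _)
  · apply hw.fourierSum_one_ne_one hk
    rw [← ha.sum_mul_stdAddChar_eq hw (x := 1), Finset.sum_eq_single 0]
    · rw [← Complex.ofReal_mul, h, zero_mul, AddChar.map_zero_eq_one]
      have : (k : ℂ) ≠ 0 := NeZero.ne _
      push_cast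
      field_simp
    · intro n _ hn
      rw [← Complex.ofReal_mul, ha'.mul_eq_zero hw h hn]
      simp
    · simp
    · rintro j - hj ⟨m, hm, hmj⟩
      rw [abs_lt] at hm
      exact hj ⟨1 - m, by rw [abs_lt]; omega, by push_cast; rw [hmj]; ring⟩

end

/-! ### Lifting to a common modulus, and strict monotonicity -/

section

variable {K k l : ℕ}

theorem mul_intCast_eq_mul_intCast_iff [NeZero l] (h : K = k * l) (i j : ℤ) :
    ((l * i : ℤ) : ZMod K) = ((l * j : ℤ) : ZMod K) ↔ (i : ZMod k) = (j : ZMod k) := by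
  have hl : (l : ℤ) ≠ 0 := by exact_mod_cast NeZero.ne l
  rw [ZMod.intCast_eq_intCast_iff_dvd_sub, ZMod.intCast_eq_intCast_iff_dvd_sub, ← mul_sub, h]
  push_cast
  rw [mul_comm (k : ℤ), mul_dvd_mul_iff_left hl]

variable [NeZero K]

/-- The weight on `ℤ / k l` obtained from a weight on `ℤ / k` by interpolating its characteristic
function with a triangular kernel of width `l`. -/
noncomputable def triangularLift (h : K = k * l) (w : ZMod k → ℝ) (n : ZMod K) : ℝ :=
  ((l : ℝ) ^ 2)⁻¹ * (w (ZMod.castHom (Dvd.intro l h.symm) (ZMod k) n) *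
    ‖∑ i ∈ Finset.range l, (ZMod.stdAddChar (n * (i : ZMod K)) : ℂ)‖ ^ 2)

theorem fourierSum_triangularLift (h : K = k * l) (w : ZMod k → ℝ) (J : ZMod K) :
    fourierSum (triangularLift h w) J = ((l : ℂ) ^ 2)⁻¹ *
      ∑ i ∈ Finset.range l, ∑ i' ∈ Finset.range l,
        fourierSum (fun n => w (ZMod.castHom (Dvd.intro l h.symm) (ZMod k) n))
          (J + ((i : ZMod K) - (i' : ZMod K))) := by
  simp only [fourierSum]
  rw [Finset.sum_congr rfl fun i _ => Finset.sum_comm, Finset.sum_comm, Finset.mul_sum]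
  refine Finset.sum_congr rfl fun n _ => ?_
  rw [triangularLift]
  push_cast
  rw [← Complex.mul_conj', map_sum, Finset.sum_mul_sum]
  simp only [Finset.mul_sum, Finset.sum_mul]
  refine Finset.sum_congr rfl fun i _ => Finset.sum_congr rfl fun i' _ => ?_
  rw [← AddChar.map_neg_eq_conj, mul_add, mul_sub, AddChar.map_add_eq_mul, sub_eq_add_neg,
    AddChar.map_add_eq_mul]
  ring

variable [NeZero l]

theorem triangularLift_zero (h : K = k * l) (w : ZMod k → ℝ) : triangularLift h w 0 = w 0 := by
  have hl : (l : ℝ) ≠ 0 := NeZero.ne _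
  simp [triangularLift]
  field_simp

variable [NeZero k]

theorem stdAddChar_castHom_mul (h : K = k * l) (n : ZMod K) (m : ℤ) :
    (ZMod.stdAddChar (ZMod.castHom (Dvd.intro l h.symm) (ZMod k) n * (m : ZMod k)) : ℂ) =
      ZMod.stdAddChar (n * ((l * m : ℤ) : ZMod K)) := by
  obtain ⟨i, rfl⟩ := ZMod.intCast_surjective n
  have hk : (k : ℂ) ≠ 0 := NeZero.ne _
  have hl : (l : ℂ) ≠ 0 := NeZero.ne _
  rw [map_intCast, ← Int.cast_mul, ← Int.cast_mul, ZMod.stdAddChar_coe, ZMod.stdAddChar_coe, h]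
  congr 1
  push_cast
  field_simp

/-- Fourier inversion on `ℤ / k`: a pulled-back weight has spectrum only at multiples of `l`. -/
theorem fourierSum_comp_castHom (h : K = k * l) (a : ZMod k → ℝ) (J : ZMod K) :
    fourierSum (fun n => a (ZMod.castHom (Dvd.intro l h.symm) (ZMod k) n)) J =
      l * ∑ m : ZMod k, if J = ((l * (m.val : ℤ) : ℤ) : ZMod K) then fourierSum a m else 0 := by
  have hk : (k : ℂ) ≠ 0 := NeZero.ne _
  have hinv : ∀ n : ZMod K, (a (ZMod.castHom (Dvd.intro l h.symm) (ZMod k) n) : ℂ) =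
      (k : ℂ)⁻¹ * ∑ m : ZMod k, fourierSum a m *
        ZMod.stdAddChar (-(n * ((l * (m.val : ℤ) : ℤ) : ZMod K))) := by
    intro n
    rw [eq_inv_mul_iff_mul_eq₀ hk, ← sum_fourierSum_mul_stdAddChar]
    refine Finset.sum_congr rfl fun m _ => ?_
    rw [AddChar.map_neg_eq_conj, AddChar.map_neg_eq_conj, ← stdAddChar_castHom_mul h]
    simp
  rw [fourierSum]
  simp only [hinv, Finset.mul_sum, Finset.sum_mul]
  rw [Finset.sum_comm]
  refine Finset.sum_congr rfl fun m _ => ?_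
  have : ∀ n : ZMod K, (k : ℂ)⁻¹ * (fourierSum a m *
      ZMod.stdAddChar (-(n * ((l * (m.val : ℤ) : ℤ) : ZMod K)))) * ZMod.stdAddChar (n * J) =
      (k : ℂ)⁻¹ * fourierSum a m *
        ZMod.stdAddChar (n * (J - ((l * (m.val : ℤ) : ℤ) : ZMod K))) := by
    intro n
    rw [mul_sub, sub_eq_neg_add, AddChar.map_add_eq_mul]
    ring
  simp only [this]
  have hK : (K : ℂ) = k * l := by rw [h]; push_cast; rfl
  rw [← Finset.mul_sum, sum_stdAddChar_mul, hK]
  simp only [sub_eq_zero]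
  split_ifs
  · field_simp
  · simp

theorem fourierSum_comp_castHom_mul (h : K = k * l) (a : ZMod k → ℝ) (j : ℤ) :
    fourierSum (fun n => a (ZMod.castHom (Dvd.intro l h.symm) (ZMod k) n))
      ((l * j : ℤ) : ZMod K) = l * fourierSum a (j : ZMod k) := by
  rw [fourierSum_comp_castHom h, Finset.sum_eq_single (j : ZMod k)]
  · rw [if_pos]
    rw [mul_intCast_eq_mul_intCast_iff h]
    simp
  · intro m _ hm
    rw [if_neg]
    rw [mul_intCast_eq_mul_intCast_iff h]
    simpa [eq_comm] using hm
  · simp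

theorem fourierSum_comp_castHom_eq_zero (h : K = k * l) (a : ZMod k → ℝ) {J : ZMod K}
    (hJ : ∀ j : ℤ, fourierSum a (j : ZMod k) ≠ 0 → J ≠ ((l * j : ℤ) : ZMod K)) :
    fourierSum (fun n => a (ZMod.castHom (Dvd.intro l h.symm) (ZMod k) n)) J = 0 := by
  rw [fourierSum_comp_castHom h, Finset.sum_eq_zero, mul_zero]
  intro m _
  split_ifs with h1
  · by_contra hne
    exact hJ m.val (by simpa using hne) h1
  · rfl

theorem IsSparseWeight.lift (h : K = k * l) {d : ℕ} {a : ZMod k → ℝ} (ha : IsSparseWeight d a) :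
    IsSparseWeight (d * l)
      ((l : ℝ)⁻¹ • fun n : ZMod K => a (ZMod.castHom (Dvd.intro l h.symm) (ZMod k) n)) := by
  have hl : (l : ℝ) ≠ 0 := NeZero.ne _
  have hl' : (0 : ℤ) < l := by exact_mod_cast Nat.pos_of_neZero l
  refine ⟨⟨fun n => mul_nonneg (by positivity) (ha.mem_stdSimplex.1 _), ?_⟩, ?_⟩
  · have h0 := fourierSum_comp_castHom_mul h a 0
    rw [mul_zero, Int.cast_zero, Int.cast_zero, fourierSum_zero, fourierSum_zero,
      ha.mem_stdSimplex.2] at h0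
    have h1 : ∑ n : ZMod K, a (ZMod.castHom (Dvd.intro l h.symm) (ZMod k) n) = l := by
      simpa using congrArg Complex.re h0
    simp only [Pi.smul_apply, smul_eq_mul, ← Finset.mul_sum, h1, inv_mul_cancel₀ hl]
  · rintro J hJ ⟨M, hM, rfl⟩
    rw [fourierSum_smul, fourierSum_comp_castHom_eq_zero h, mul_zero]
    intro j hj hMj
    obtain ⟨t, ht⟩ := (ZMod.intCast_eq_intCast_iff_dvd_sub _ _ _).1 hMj
    -- The short representative `M` is itself a multiple of `l`, so its size bound descends to a
    -- representative of `j`.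
    have hMt : M = l * (j - k * t) := by
      rw [h] at ht
      push_cast at ht
      linarith
    apply hj
    have hcast : ((j - k * t : ℤ) : ZMod k) = j := by simp
    rw [← hcast]
    refine ha.fourierSum_eq_zero _ (fun h0 => hJ ?_) ⟨_, ?_, rfl⟩
    · rw [hcast] at h0
      rw [hMj, ← Int.cast_zero, ← mul_zero (l : ℤ), mul_intCast_eq_mul_intCast_iff h, h0,
        Int.cast_zero]
    · rw [hMt, abs_mul, abs_of_pos hl'] at hM
      push_cast at hM
      rw [mul_comm (d : ℤ)] at hM
      exact lt_of_mul_lt_mul_left hM hl'.le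

theorem IsLocalWeight.triangularLift (h : K = k * l) {d : ℕ} {w : ZMod k → ℝ}
    (hw : IsLocalWeight d w) : IsLocalWeight (d * l) (triangularLift h w) := by
  have hl : (l : ℂ) ≠ 0 := NeZero.ne _
  have hl' : (0 : ℤ) < l := by exact_mod_cast Nat.pos_of_neZero l
  refine ⟨⟨fun n => mul_nonneg (by positivity) (mul_nonneg (hw.mem_stdSimplex.1 _)
    (by positivity)), ?_⟩, fun J hJ => ?_⟩
  · have hsum := fourierSum_triangularLift h w 0
    have hterm : ∀ i ∈ Finset.range l, ∀ i' ∈ Finset.range l,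
        fourierSum (fun n => w (ZMod.castHom (Dvd.intro l h.symm) (ZMod k) n))
          (0 + ((i : ZMod K) - (i' : ZMod K))) = if i = i' then (l : ℂ) else 0 := by
      intro i hi i' hi'
      rw [Finset.mem_range] at hi hi'
      split_ifs with hii
      · have := fourierSum_comp_castHom_mul h w 0
        rw [mul_zero, Int.cast_zero, Int.cast_zero, fourierSum_zero_of_mem hw.mem_stdSimplex,
          mul_one] at this
        rw [hii, sub_self, add_zero, this]
      · apply fourierSum_comp_castHom_eq_zero h
        intro j _ hj
        have hj' : (((i : ℤ) - i' : ℤ) : ZMod K) = ((l * j : ℤ) : ZMod K) := by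
          rw [← hj]; push_cast; ring
        obtain ⟨t, ht⟩ := (ZMod.intCast_eq_intCast_iff_dvd_sub _ _ _).1 hj'
        have hdvd : (l : ℤ) ∣ (i : ℤ) - i' := ⟨j - k * t, by rw [h] at ht; push_cast at ht; linarith⟩
        have := Int.eq_zero_of_abs_lt_dvd hdvd (by rw [abs_lt]; omega)
        omega
    rw [Finset.sum_congr rfl fun i hi => Finset.sum_congr rfl fun i' hi' => hterm i hi i' hi'] at hsum
    rw [Finset.sum_congr rfl fun i hi => by rw [Finset.sum_ite_eq, if_pos hi], Finset.sum_const,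
      Finset.card_range, nsmul_eq_mul, ← sq, inv_mul_cancel₀ (pow_ne_zero 2 hl),
      fourierSum_zero] at hsum
    exact_mod_cast hsum
  · rw [fourierSum_triangularLift, Finset.sum_eq_zero, mul_zero]
    intro i hi
    refine Finset.sum_eq_zero fun i' hi' => fourierSum_comp_castHom_eq_zero h _ fun j hj hJj => ?_
    rw [Finset.mem_range] at hi hi'
    obtain ⟨m, hm, hmj⟩ : IsNear d (j : ZMod k) := by
      by_contra hn
      exact hj (hw.fourierSum_eq_zero _ hn)
    -- The kernel moves frequencies by at most `l - 1`, and `l * (d - 1) + (l - 1) < d * l`.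
    refine hJ ⟨l * m + (i' - i), ?_, ?_⟩
    · rw [abs_lt] at hm ⊢
      push_cast
      constructor <;> nlinarith
    · rw [Int.cast_add, (mul_intCast_eq_mul_intCast_iff h m j).2 hmj, ← hJj]
      push_cast
      ring

end

/-- Lifting divides `a 0` by `k'` and keeps `w' 0`, so the strict gap at modulus `k * k'` reads `k *
a 0 * w' 0 < 1 = k' * a' 0 * w' 0`. -/
theorem lovaszTheta_compl_circularComplete_lt {k d k' d' : ℕ} (hd : 1 ≤ d) (hd' : 1 ≤ d')
    (hk : 2 * d ≤ k) (hk' : 2 * d' ≤ k') (hlt : d' * k < d * k') :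
    lovaszTheta (circularComplete k d)ᶜ < lovaszTheta (circularComplete k' d')ᶜ := by
  have : NeZero k := ⟨by omega⟩
  have : NeZero k' := ⟨by omega⟩
  obtain ⟨a, w, ha, hw, h⟩ := exists_isSparseWeight_isLocalWeight (k := k) hd
  obtain ⟨a', w', ha', hw', h'⟩ := exists_isSparseWeight_isLocalWeight (k := k') hd'
  rw [lovaszTheta_compl_circularComplete hd ha hw h,
    lovaszTheta_compl_circularComplete hd' ha' hw' h']
  have hk0 : (0 : ℝ) < k := by exact_mod_cast Nat.pos_of_neZero k
  have hk0' : (0 : ℝ) < k' := by exact_mod_cast Nat.pos_of_neZero k'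
  have hw0 : 0 ≤ w' 0 := hw'.mem_stdSimplex.1 0
  have key := (ha.lift (K := k * k') rfl).mul_lt
    (by nlinarith) hlt (hw'.triangularLift (mul_comm k k'))
  rw [triangularLift_zero] at key
  simp only [Pi.smul_apply, smul_eq_mul, map_zero] at key
  push_cast at key
  by_contra! hle
  have h1 : k' * a' 0 * w' 0 = 1 := by rw [mul_assoc, h', mul_inv_cancel₀ hk0'.ne']
  have h2 : k * a 0 * w' 0 < 1 := by
    have := mul_lt_mul_of_pos_left key (mul_pos hk0 hk0')
    rw [mul_inv_cancel₀ (mul_pos hk0 hk0').ne'] at this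
    refine lt_of_eq_of_lt ?_ this
    field_simp
  have := mul_le_mul_of_nonneg_right hle hw0
  linarith

/-! ### Lower bounds for cyclotomic integers -/

-- The field norm is a nonzero rational integer and the product of the values of `A` at the
-- conjugates of `ζ`; at most `M - 1` factors other than the one at `ζ` occur, each bounded by `R`.
open Polynomial in
theorem one_le_norm_aeval_mul_pow_of_isCyclotomicExtension {M : ℕ} [NeZero M] (F : Type*)
    [Field F] [Algebra ℚ F] [IsCyclotomicExtension {M} ℚ F] {ζ : ℂ} (hζ : IsPrimitiveRoot ζ M)
    (A : ℤ[X]) (hA : aeval ζ A ≠ 0) {R : ℝ} (hR : 1 ≤ R)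
    (hb : ∀ ξ : ℂ, ξ ^ M = 1 → ‖aeval ξ A‖ ≤ R) : 1 ≤ ‖aeval ζ A‖ * R ^ (M - 1) := by
  classical
  have : FiniteDimensional ℚ F := IsCyclotomicExtension.finiteDimensional {M} ℚ F
  set z : F := IsCyclotomicExtension.zeta M ℚ F
  have hz : IsPrimitiveRoot z M := IsCyclotomicExtension.zeta_spec M ℚ F
  have hirr := cyclotomic.irreducible_rat (Nat.pos_of_neZero M)
  have hσ : ∀ σ : F →ₐ[ℚ] ℂ, σ (aeval z A) = aeval (σ z) A := fun σ => by
    rw [aeval_def, aeval_def, ← AlgHom.coe_toRingHom, hom_eval₂]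
    congr 1
    exact RingHom.ext_int _ _
  obtain ⟨σ₀, hσ₀⟩ : ∃ σ₀ : F →ₐ[ℚ] ℂ, σ₀ z = ζ := by
    refine ⟨(hz.embeddingsEquivPrimitiveRoots ℂ hirr).symm
      ⟨ζ, (mem_primitiveRoots (Nat.pos_of_neZero M)).2 hζ⟩, ?_⟩
    rw [← hz.embeddingsEquivPrimitiveRoots_apply_coe ℂ hirr, Equiv.apply_symm_apply]
  have hint : IsIntegral ℤ (aeval z A) := by
    have : IsIntegral ℤ z := hz.isIntegral (Nat.pos_of_neZero M)
    exact adjoin_le_integralClosure this (aeval_mem_adjoin_singleton ℤ z)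
  have hne : aeval z A ≠ 0 := fun h => hA (by rw [← hσ₀, ← hσ, h, map_zero])
  have hnorm : 1 ≤ ‖algebraMap ℚ ℂ (Algebra.norm ℚ (aeval z A))‖ := by
    obtain ⟨t, ht⟩ := IsIntegrallyClosed.isIntegral_iff.1 (Algebra.isIntegral_norm ℚ hint)
    have ht0 : t ≠ 0 := by
      rintro rfl
      rw [map_zero, eq_comm, Algebra.norm_eq_zero_iff] at ht
      exact hne ht
    rw [← ht]
    simp only [eq_ratCast, algebraMap_int_eq, eq_intCast, Rat.cast_intCast, Complex.norm_intCast]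
    exact_mod_cast Int.one_le_abs ht0
  rw [Algebra.norm_eq_prod_embeddings ℚ ℂ, norm_prod,
    ← Finset.mul_prod_erase _ _ (Finset.mem_univ σ₀), hσ, hσ₀] at hnorm
  refine hnorm.trans (mul_le_mul_of_nonneg_left ?_ (norm_nonneg _))
  have hcard : (Finset.univ.erase σ₀).card ≤ M - 1 := by
    rw [Finset.card_erase_of_mem (Finset.mem_univ _), Finset.card_univ, AlgHom.card,
      IsCyclotomicExtension.finrank F hirr]
    exact Nat.sub_le_sub_right (Nat.totient_le M) 1
  refine (Finset.prod_le_prod (fun σ _ => norm_nonneg _) fun σ _ => ?_).trans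
    ((Finset.prod_const R).trans_le (pow_le_pow_right₀ hR hcard))
  rw [hσ]
  exact hb _ (by rw [← map_pow, hz.pow_eq_one, map_one])

open Polynomial in
theorem one_le_norm_aeval_mul_pow {M : ℕ} [NeZero M] {ζ : ℂ} (hζ : IsPrimitiveRoot ζ M)
    (A : ℤ[X]) (hA : aeval ζ A ≠ 0) {R : ℝ} (hR : 1 ≤ R)
    (hb : ∀ ξ : ℂ, ξ ^ M = 1 → ‖aeval ξ A‖ ≤ R) : 1 ≤ ‖aeval ζ A‖ * R ^ (M - 1) :=
  @one_le_norm_aeval_mul_pow_of_isCyclotomicExtension M _ (CyclotomicField M ℚ) _ _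
    (CyclotomicField.isCyclotomicExtension M ℚ) _ hζ A hA _ hR hb

open Polynomial in
theorem norm_coeff_prod_X_sub_C_le {ι : Type*} (s : Finset ι) (u : ι → ℂ)
    (hu : ∀ i ∈ s, ‖u i‖ ≤ 1) (j : ℕ) : ‖(∏ i ∈ s, (X - C (u i))).coeff j‖ ≤ 2 ^ s.card := by
  classical
  induction s using Finset.induction_on generalizing j with
  | empty =>
    simp only [Finset.prod_empty, Finset.card_empty, pow_zero, coeff_one]
    split_ifs <;> simp
  | insert i s hi ih =>
    have ih' := ih fun i' hi' => hu i' (Finset.mem_insert_of_mem hi')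
    rw [Finset.prod_insert hi, Finset.card_insert_of_notMem hi, sub_mul, coeff_sub, coeff_C_mul,
      pow_succ, mul_two]
    refine (norm_sub_le _ _).trans (add_le_add ?_ ?_)
    · cases j with
      | zero => simp
      | succ j => rw [coeff_X_mul]; exact ih' j
    · rw [norm_mul]
      exact (mul_le_of_le_one_left (norm_nonneg _)
        (hu i (Finset.mem_insert_self i s))).trans (ih' j)

theorem norm_prod_one_sub_le {ι : Type*} (s : Finset ι) (u : ι → ℂ)
    (hu : ∀ i ∈ s, ‖u i‖ ≤ 1) : ‖∏ i ∈ s, (1 - u i)‖ ≤ 2 ^ s.card := by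
  rw [norm_prod]
  refine (Finset.prod_le_prod (fun i _ => norm_nonneg _) fun i hi => (norm_sub_le _ _).trans ?_).trans
    (Finset.prod_const 2).le
  rw [norm_one]
  linarith [hu i hi]

/-! ### The theta number as a quotient in roots of unity -/

theorem exists_natCast_eq_add {k d : ℕ} {m : ZMod k} (hm : IsNear d m) :
    ∃ e : ℕ, e ≤ 2 * d - 2 ∧ (e : ZMod k) = m + (d - 1 : ℕ) := by
  obtain ⟨i, hi, rfl⟩ := hm
  rw [abs_lt] at hi
  refine ⟨(i + (d - 1 : ℕ)).toNat, by omega, ?_⟩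
  rw [← Int.cast_natCast, Int.toNat_of_nonneg (by omega)]
  push_cast
  rfl

section

variable {k : ℕ} [NeZero k]

-- Up to a unimodular factor, `k * w n` is the value at a root of unity of a nonzero polynomial of
-- degree at most `2 * d - 2`.
open Polynomial in
theorem IsLocalWeight.card_le {d : ℕ} {w : ZMod k → ℝ} (hw : IsLocalWeight d w)
    (s : Finset (ZMod k)) (hs : ∀ n ∈ s, w n = 0) : s.card ≤ 2 * d - 2 := by
  classical
  have hex : ∀ m : ZMod k, ∃ e : ℕ, e ≤ 2 * d - 2 ∧
      (IsNear d m → (e : ZMod k) = m + (d - 1 : ℕ)) := fun m => by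
    by_cases hm : IsNear d m
    · obtain ⟨e, he, h⟩ := exists_natCast_eq_add hm
      exact ⟨e, he, fun _ => h⟩
    -- The exponent is immaterial here: the transform of `w` vanishes at such `m`.
    · exact ⟨0, Nat.zero_le _, fun h => absurd h hm⟩
  choose e he hem using hex
  set p : ℂ[X] := ∑ m, C (fourierSum w m) * X ^ e m with hp
  have heval : ∀ n : ZMod k, p.eval (ZMod.stdAddChar (-n)) =
      ZMod.stdAddChar (-(n * ((d - 1 : ℕ) : ZMod k))) * (k * w n) := by
    intro n
    rw [hp, eval_finsetSum, ← sum_fourierSum_mul_stdAddChar, Finset.mul_sum]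
    refine Finset.sum_congr rfl fun m _ => ?_
    rw [eval_mul, eval_C, eval_pow, eval_X]
    by_cases hm : IsNear d m
    · rw [mul_left_comm, ← AddChar.map_add_eq_mul, ← AddChar.map_nsmul_eq_pow, nsmul_eq_mul,
        hem m hm]
      congr 2
      ring
    · rw [hw.fourierSum_eq_zero m hm]
      ring
  have hdeg : p.natDegree ≤ 2 * d - 2 :=
    natDegree_sum_le_of_forall_le _ _ fun m _ => (natDegree_C_mul_X_pow_le _ _).trans (he m)
  have hp0 : p ≠ 0 := by
    intro h
    have h0 : ∀ n, w n = 0 := fun n => by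
      have := heval n
      rw [h, eval_zero, eq_comm, mul_eq_zero, mul_eq_zero] at this
      rcases this with h | h | h
      · exact absurd h (by simp [← norm_ne_zero_iff])
      · exact absurd h (NeZero.ne _)
      · exact_mod_cast h
    have := hw.mem_stdSimplex.2
    simp [h0] at this
  have hinj : Function.Injective fun n : ZMod k => (ZMod.stdAddChar (-n) : ℂ) :=
    ZMod.injective_stdAddChar.comp neg_injective
  rw [← Finset.card_image_of_injective s hinj]
  refine (card_le_degree_of_subset_roots fun x hx => ?_).trans hdeg
  rw [Finset.mem_val] at hx
  obtain ⟨n, hn, rfl⟩ := Finset.mem_image.1 hx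
  rw [mem_roots hp0, IsRoot.def, heval, hs n hn]
  simp

-- Sum `a` against `q` shifted down by `d - 1`. In space, `q` kills the support except `0`; in
-- frequency, all exponents lie strictly between `-d` and `d`, so only the middle coefficient
-- remains.
open Polynomial in
theorem IsSparseWeight.apply_zero_mul_prod {d : ℕ} (hd : 1 ≤ d) (hk : 2 * d ≤ k)
    {a : ZMod k → ℝ} (ha : IsSparseWeight d a) (s : Finset (ZMod k))
    (hs : ∀ n, n ∈ s ↔ n ≠ 0 ∧ a n ≠ 0) (hcard : s.card ≤ 2 * d - 2) :
    (a 0 : ℂ) * ∏ n ∈ s, (1 - ZMod.stdAddChar n) =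
      (∏ n ∈ s, (X - C (ZMod.stdAddChar n : ℂ))).coeff (d - 1) := by
  classical
  set q : ℂ[X] := ∏ n ∈ s, (X - C (ZMod.stdAddChar n : ℂ)) with hq
  have hdeg : q.natDegree < 2 * d - 1 := by
    rw [hq, natDegree_finsetProd_X_sub_C_eq_card]
    omega
  have h1 : ∑ n, (a n : ℂ) * (q.eval (ZMod.stdAddChar n) *
      ZMod.stdAddChar (-(n * ((d - 1 : ℕ) : ZMod k)))) = a 0 * ∏ n ∈ s, (1 - ZMod.stdAddChar n) := by
    rw [Finset.sum_eq_single 0]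
    · simp [hq, eval_prod]
    · intro n _ hn
      by_cases han : a n = 0
      · simp [han]
      · rw [hq, eval_prod, Finset.prod_eq_zero ((hs n).2 ⟨hn, han⟩) (by simp)]
        simp
    · simp
  rw [← h1]
  have h2 : ∀ n : ZMod k, (a n : ℂ) * (q.eval (ZMod.stdAddChar n) *
      ZMod.stdAddChar (-(n * ((d - 1 : ℕ) : ZMod k)))) = ∑ i ∈ Finset.range (2 * d - 1),
        q.coeff i * (a n * ZMod.stdAddChar (n * ((i : ZMod k) - ((d - 1 : ℕ) : ZMod k)))) := by
    intro n
    rw [eval_eq_sum_range' hdeg, Finset.sum_mul, Finset.mul_sum]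
    refine Finset.sum_congr rfl fun i _ => ?_
    rw [mul_sub, sub_eq_add_neg, AddChar.map_add_eq_mul, ← AddChar.map_nsmul_eq_pow,
      nsmul_eq_mul, mul_comm (i : ZMod k)]
    ring
  simp only [h2]
  rw [Finset.sum_comm]
  simp only [← Finset.mul_sum]
  rw [Finset.sum_eq_single (d - 1)]
  · rw [sub_self, ← fourierSum, fourierSum_zero_of_mem ha.mem_stdSimplex, mul_one]
  · intro i hi hid
    rw [Finset.mem_range] at hi
    rw [← fourierSum, ha.fourierSum_eq_zero, mul_zero]
    · rw [sub_ne_zero]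
      intro h
      have := (ZMod.natCast_eq_natCast_iff' _ _ _).1 h
      rw [Nat.mod_eq_of_lt (by omega), Nat.mod_eq_of_lt (by omega)] at this
      exact hid this
    · exact ⟨(i : ℤ) - (d - 1 : ℕ), by rw [abs_lt]; omega, by push_cast; rfl⟩
  · intro h
    exact absurd (Finset.mem_range.2 (by omega)) h

end

open Polynomial in
theorem exists_finset_lovaszTheta_mul_prod {k d : ℕ} [NeZero k] (hd : 1 ≤ d) (hk : 2 * d ≤ k) :
    ∃ s : Finset (ZMod k), 0 ∉ s ∧
      (lovaszTheta (circularComplete k d)ᶜ : ℂ) * ∏ n ∈ s, (1 - ZMod.stdAddChar n) =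
        k * (∏ n ∈ s, (X - C (ZMod.stdAddChar n : ℂ))).coeff (d - 1) := by
  classical
  obtain ⟨a, w, ha, hw, h⟩ := exists_isSparseWeight_isLocalWeight (k := k) hd
  refine ⟨Finset.univ.filter fun n => n ≠ 0 ∧ a n ≠ 0, by simp, ?_⟩
  rw [lovaszTheta_compl_circularComplete hd ha hw h, ← ha.apply_zero_mul_prod hd hk]
  · push_cast
    ring
  · simp
  · refine hw.card_le _ fun n hn => ?_
    rw [Finset.mem_filter] at hn
    exact (mul_eq_zero.1 (ha.mul_eq_zero hw h hn.2.1)).resolve_left hn.2.2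

/-! ### The difference of two theta numbers -/

theorem isPrimitiveRoot_stdAddChar_one (K : ℕ) [NeZero K] :
    IsPrimitiveRoot (ZMod.stdAddChar (1 : ZMod K) : ℂ) K := by
  have := Complex.isPrimitiveRoot_exp K (NeZero.ne K)
  rw [← Int.cast_one, ZMod.stdAddChar_coe]
  simpa using this

theorem stdAddChar_eq_pow {K k l : ℕ} [NeZero K] [NeZero k] [NeZero l] (h : K = k * l)
    (n : ZMod k) :
    (ZMod.stdAddChar n : ℂ) = (ZMod.stdAddChar (1 : ZMod K) : ℂ) ^ (l * n.val) := by
  have := stdAddChar_castHom_mul h 1 n.val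
  rw [map_one, one_mul, one_mul, Int.cast_natCast, ZMod.natCast_zmod_val] at this
  rw [this, ← AddChar.map_nsmul_eq_pow, nsmul_eq_mul, mul_one]
  push_cast
  rfl

section

open Polynomial

/-- The coefficient of `X ^ j` in `∏ n ∈ s, (X - ζ ^ e n)`, as an integer polynomial in `ζ`. -/
noncomputable def coeffPoly {ι : Type*} (s : Finset ι) (e : ι → ℕ) (j : ℕ) : ℤ[X] :=
  (∏ n ∈ s, (X - C (X ^ e n)) : ℤ[X][X]).coeff j

theorem aeval_coeffPoly {ι : Type*} (s : Finset ι) (e : ι → ℕ) (j : ℕ) (ξ : ℂ) :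
    aeval ξ (coeffPoly s e j) = (∏ n ∈ s, (X - C (ξ ^ e n))).coeff j := by
  have := (coeff_map (p := (∏ n ∈ s, (X - C (X ^ e n)) : ℤ[X][X]))
    (aeval ξ : ℤ[X] →ₐ[ℤ] ℂ).toRingHom j).symm
  refine this.trans ?_
  rw [Polynomial.map_prod]
  simp

/-- The integer polynomial in `ζ` expressing the difference of two quotients whose numerators and
denominators are the coefficients, respectively the values at `1`, of products of `X - ζ ^ e n`. -/
noncomputable def crossPoly {ι κ : Type*} (s : Finset ι) (e : ι → ℕ) (t : Finset κ) (f : κ → ℕ)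
    (k l i j : ℕ) : ℤ[X] :=
  (k : ℤ[X]) * coeffPoly s e i * ∏ n ∈ t, (1 - X ^ f n) -
    (l : ℤ[X]) * coeffPoly t f j * ∏ n ∈ s, (1 - X ^ e n)

theorem aeval_crossPoly {ι κ : Type*} (s : Finset ι) (e : ι → ℕ) (t : Finset κ) (f : κ → ℕ)
    (k l i j : ℕ) (ξ : ℂ) :
    aeval ξ (crossPoly s e t f k l i j) =
      k * (∏ n ∈ s, (X - C (ξ ^ e n))).coeff i * ∏ n ∈ t, (1 - ξ ^ f n) -
        l * (∏ n ∈ t, (X - C (ξ ^ f n))).coeff j * ∏ n ∈ s, (1 - ξ ^ e n) := by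
  simp [crossPoly, aeval_coeffPoly, map_prod]

theorem norm_aeval_crossPoly_le {ι κ : Type*} (s : Finset ι) (e : ι → ℕ) (t : Finset κ)
    (f : κ → ℕ) {k l N : ℕ} (i j : ℕ) (hk : k ≤ N) (hl : l ≤ N) (hs : s.card ≤ N)
    (ht : t.card ≤ N) {ξ : ℂ} (hξ : ‖ξ‖ = 1) :
    ‖aeval ξ (crossPoly s e t f k l i j)‖ ≤ 2 * N * 4 ^ N := by
  have hle : ∀ m : ℕ, ‖ξ ^ m‖ ≤ 1 := fun m => by rw [norm_pow, hξ, one_pow]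
  have hpow : ∀ m ≤ N, (2 : ℝ) ^ m ≤ 2 ^ N := fun m hm => pow_le_pow_right₀ one_le_two hm
  have hterm : ∀ (m : ℕ) (x y : ℂ), m ≤ N → ‖x‖ ≤ 2 ^ N → ‖y‖ ≤ 2 ^ N →
      ‖(m : ℂ) * x * y‖ ≤ N * 2 ^ N * 2 ^ N := by
    intro m x y hm hx hy
    rw [norm_mul, norm_mul, Complex.norm_natCast]
    gcongr
  have h4 : (4 : ℝ) ^ N = 2 ^ N * 2 ^ N := by rw [← mul_pow]; norm_num
  rw [aeval_crossPoly]
  refine (norm_sub_le _ _).trans ((add_le_add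
    (hterm k _ _ hk ((norm_coeff_prod_X_sub_C_le s _ (fun n _ => hle _) i).trans (hpow _ hs))
      ((norm_prod_one_sub_le t _ fun n _ => hle _).trans (hpow _ ht)))
    (hterm l _ _ hl ((norm_coeff_prod_X_sub_C_le t _ (fun n _ => hle _) j).trans (hpow _ ht))
      ((norm_prod_one_sub_le s _ fun n _ => hle _).trans (hpow _ hs)))).trans_eq ?_)
  rw [h4]
  ring

end

theorem one_le_abs_lovaszTheta_sub_mul_pow {N k d k' d' : ℕ} (hd : 1 ≤ d) (hd' : 1 ≤ d')
    (hkN : k ≤ N) (hkN' : k' ≤ N) (hk : 2 * d ≤ k) (hk' : 2 * d' ≤ k')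
    (hne : lovaszTheta (circularComplete k d)ᶜ ≠ lovaszTheta (circularComplete k' d')ᶜ) :
    1 ≤ |lovaszTheta (circularComplete k d)ᶜ - lovaszTheta (circularComplete k' d')ᶜ| *
      (2 * N * 4 ^ N) ^ (k * k') := by
  have : NeZero k := ⟨by omega⟩
  have : NeZero k' := ⟨by omega⟩
  obtain ⟨s, hs0, hs⟩ := exists_finset_lovaszTheta_mul_prod hd hk
  obtain ⟨t, ht0, ht⟩ := exists_finset_lovaszTheta_mul_prod hd' hk'
  set θ := lovaszTheta (circularComplete k d)ᶜ
  set θ' := lovaszTheta (circularComplete k' d')ᶜ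
  set ζ : ℂ := ZMod.stdAddChar (1 : ZMod (k * k')) with hζ
  have hprim : IsPrimitiveRoot ζ (k * k') := isPrimitiveRoot_stdAddChar_one _
  have hχ : ∀ n : ZMod k, (ZMod.stdAddChar n : ℂ) = ζ ^ (k' * n.val) := stdAddChar_eq_pow rfl
  have hχ' : ∀ n : ZMod k', (ZMod.stdAddChar n : ℂ) = ζ ^ (k * n.val) :=
    stdAddChar_eq_pow (mul_comm k k')
  have hprod : ∀ (m : ℕ) [NeZero m] (u : Finset (ZMod m)), 0 ∉ u →
      ∏ n ∈ u, (1 - ZMod.stdAddChar n : ℂ) ≠ 0 := by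
    intro m _ u hu
    refine Finset.prod_ne_zero_iff.2 fun n hn h => hu ?_
    rw [sub_eq_zero, ← AddChar.map_zero_eq_one (ZMod.stdAddChar : AddChar (ZMod m) ℂ),
      ZMod.injective_stdAddChar.eq_iff] at h
    rwa [h]
  have hs0' := hprod k s hs0
  have ht0' := hprod k' t ht0
  have hcard : s.card ≤ N := (Finset.card_le_univ s).trans (by rwa [ZMod.card])
  have htcard : t.card ≤ N := (Finset.card_le_univ t).trans (by rwa [ZMod.card])
  simp only [hχ] at hs hs0'
  simp only [hχ'] at ht ht0'
  set A := crossPoly s (fun n => k' * n.val) t (fun n => k * n.val) k k' (d - 1) (d' - 1)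
  set R : ℝ := 2 * N * 4 ^ N with hR
  have hN : (1 : ℝ) ≤ N := by exact_mod_cast (show 1 ≤ N by omega)
  have h4 : (1 : ℝ) ≤ 4 ^ N := one_le_pow₀ (by norm_num)
  have hR1 : 4 ^ N ≤ R := by nlinarith
  have hA : Polynomial.aeval ζ A = ((θ - θ' : ℝ) : ℂ) *
      ((∏ n ∈ s, (1 - ζ ^ (k' * n.val))) * ∏ n ∈ t, (1 - ζ ^ (k * n.val))) := by
    rw [aeval_crossPoly, ← hs, ← ht]
    push_cast
    ring
  have hA0 : Polynomial.aeval ζ A ≠ 0 := by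
    rw [hA]
    refine mul_ne_zero ?_ (mul_ne_zero hs0' ht0')
    exact_mod_cast sub_ne_zero.2 hne
  have hK : k * k' ≠ 0 := NeZero.ne _
  have key := one_le_norm_aeval_mul_pow hprim A hA0 (h4.trans hR1) fun ξ hξ =>
    norm_aeval_crossPoly_le s _ t _ _ _ hkN hkN' hcard htcard
      (Complex.norm_eq_one_of_pow_eq_one hξ hK)
  have hζle : ∀ m : ℕ, ‖ζ ^ m‖ ≤ 1 := fun m => by
    rw [norm_pow, hprim.norm'_eq_one hK, one_pow]
  -- The cleared denominators cost one more factor `R`, raising the exponent from `k * k' - 1` to `k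
  -- * k'`.
  have hQ : ‖(∏ n ∈ s, (1 - ζ ^ (k' * n.val))) * ∏ n ∈ t, (1 - ζ ^ (k * n.val))‖ ≤ R := by
    refine le_trans ?_ hR1
    rw [norm_mul, show (4 : ℝ) = 2 * 2 by norm_num, mul_pow]
    gcongr
    · exact (norm_prod_one_sub_le s _ fun n _ => hζle _).trans
        (pow_le_pow_right₀ one_le_two hcard)
    · exact (norm_prod_one_sub_le t _ fun n _ => hζle _).trans
        (pow_le_pow_right₀ one_le_two htcard)
  rw [hA, norm_mul, Complex.norm_real, Real.norm_eq_abs] at key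
  refine key.trans ?_
  rw [← Nat.sub_add_cancel (Nat.one_le_iff_ne_zero.2 hK), pow_succ', ← mul_assoc]
  simp only [Nat.add_sub_cancel]
  have hR0 : 0 ≤ R := by positivity
  gcongr

theorem two_mul_mul_four_pow_pow_le {N M : ℕ} (hN : 1 ≤ N) (hM : M ≤ N ^ 2) :
    ((2 : ℝ) * N * 4 ^ N) ^ M ≤ 64 ^ (N ^ 5) := by
  have h1 : (N : ℝ) ≤ 2 ^ N := by exact_mod_cast Nat.lt_two_pow_self.le
  have h2 : (2 : ℝ) ≤ 2 ^ N := by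
    simpa using pow_le_pow_right₀ (one_le_two : (1 : ℝ) ≤ 2) hN
  have hle : (2 : ℝ) * N * 4 ^ N ≤ 64 ^ N := by
    calc (2 : ℝ) * N * 4 ^ N ≤ 2 ^ N * 2 ^ N * 4 ^ N := by gcongr
      _ = 16 ^ N := by rw [← mul_pow, ← mul_pow]; norm_num
      _ ≤ 64 ^ N := by gcongr; norm_num
  calc ((2 : ℝ) * N * 4 ^ N) ^ M ≤ (64 ^ N) ^ M := by gcongr
    _ = 64 ^ (N * M) := (pow_mul _ _ _).symm
    _ ≤ 64 ^ (N ^ 5) := pow_le_pow_right₀ (by norm_num) (by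
      calc N * M ≤ N * N ^ 2 := Nat.mul_le_mul_left _ hM
        _ = N ^ 3 := by ring
        _ ≤ N ^ 5 := Nat.pow_le_pow_right hN (by norm_num))

theorem theorem3 :
    ∃ c : ℝ, 0 < c ∧ c ≤ 64 ∧
      ∀ N k d k' d' : ℕ, 1 ≤ d → 1 ≤ d' → k ≤ N → k' ≤ N → 2 * d ≤ k → 2 * d' ≤ k' →
        Nat.Coprime k d → Nat.Coprime k' d' → (k : ℚ) / (d : ℚ) ≠ (k' : ℚ) / (d' : ℚ) →
        1 / c ^ (N ^ 5) ≤
          |lovaszTheta (circularComplete k d)ᶜ - lovaszTheta (circularComplete k' d')ᶜ| := by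
  refine ⟨64, by norm_num, le_rfl, fun N k d k' d' hd hd' hkN hkN' hk hk' _ _ hne => ?_⟩
  have hne' : lovaszTheta (circularComplete k d)ᶜ ≠ lovaszTheta (circularComplete k' d')ᶜ := by
    have hd0 : (d : ℚ) ≠ 0 := by exact_mod_cast (by omega : d ≠ 0)
    have hd0' : (d' : ℚ) ≠ 0 := by exact_mod_cast (by omega : d' ≠ 0)
    rw [ne_eq, div_eq_div_iff hd0 hd0'] at hne
    have hne : k * d' ≠ k' * d := fun h => hne (by exact_mod_cast h)
    rcases hne.lt_or_gt with h | h
    · exact (lovaszTheta_compl_circularComplete_lt hd hd' hk hk' (by linarith)).ne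
    · exact (lovaszTheta_compl_circularComplete_lt hd' hd hk' hk (by linarith)).ne'
  have key := one_le_abs_lovaszTheta_sub_mul_pow hd hd' hkN hkN' hk hk' hne'
  rw [div_le_iff₀ (by positivity)]
  refine key.trans (mul_le_mul_of_nonneg_left ?_ (abs_nonneg _))
  exact two_mul_mul_four_pow_pow_le (by omega)
    ((Nat.mul_le_mul hkN hkN').trans_eq (sq N).symm)
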